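/- Let $k\ge 0$ be an integer. For an integer $n\ge 0$ and a tensor $M=(M_{i_1\cdots i_{2k}})_{0\le i_1,\dots,i_{2k}\le n-1}$ of order $2k$ and dimension $n$ with complex entries, let $$\operatorname{Det}(M)=\frac1{n!}\sum_{\sigma_1,\dots,\sigma_{2k}}\epsilon(\sigma_1)\cdots\epsilon(\sigma_{2k})\prod_{i=0}^{n-1}M_{\sigma_1(i)\cdots\sigma_{2k}(i)}$$ be its (Cayley) hyperdeterminant, where each $\sigma_s$ runs over the permutations of $\{0,\dots,n-1\}$ and $\epsilon$ is the sign. Let $\mathrm B(u,v)=\int_0^1x^{u-1}(1-x)^{v-1}\,dx$ and, for $I=(i_1,\dots,i_{2k})$, let $|I|=i_1+\cdots+i_{2k}$. Write $\Delta(x)=\det(x_i^{j-1})_{1\le i,j\le n}$ for the Vandermonde determinant. (i) For every integer $n\ge0$ and all $a,b\in\mathbb C$ with $\operatorname{Re}a>0$ and $\operatorname{Re}b>0$, the integral $$\mathcal S_n(a,b;k)=\int_{[0,1]^n}|\Delta(x)|^{2k}\prod_{i=1}^n x_i^{a-1}(1-x_i)^{b-1}\,dx_1\cdots dx_n$$ converges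 absolutely, and $$\mathcal S_n(a,b;k)=n!\,\operatorname{Det}\bigl(\mathrm B(a+|I|,b)\bigr)_0^{n-1}=\prod_{j=0}^{n-1}\frac{\Gamma(a+jk)\,\Gamma(b+jk)\,\Gamma((j+1)k+1)}{\Gamma(a+b+(n+j-1)k)\,\Gamma(k+1)}.$$ (ii) There are constants $\alpha_{n,k}$ $(n\ge 0)$, independent of $a$ and $b$, such that for every $n\ge0$ and all $a,b\in\mathbb C$ with $\operatorname{Re}a,\operatorname{Re}b>0$, $$\operatorname{Det}\bigl(\mathrm B(a+|I|,b)\bigr)_0^{n-1}=\alpha_{n,k}\prod_{j=0}^{n-1}\frac{\Gamma(a+jk)\,\Gamma(b+jk)}{\Gamma(a+b+(n+j-1)k)},$$ and they satisfy $\displaystyle\alpha_{n,k}=\frac{(nk)!}{n\,k!}\,\alpha_{n-1,k}$ for every $n\ge1$. -/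

import Mathlib

open MeasureTheory

noncomputable section

/-- The Cayley hyperdeterminant of a tensor of even order `2k` and dimension `n`:
`(1/n!) ∑_{σ₁,…,σ₂ₖ} ε(σ₁)⋯ε(σ₂ₖ) ∏ᵢ M_{σ₁(i)…σ₂ₖ(i)}`, each `σₛ` running over the
symmetric group on the `n` values of an index. -/
def hyperdet {n k : ℕ} (M : (Fin (2 * k) → Fin n) → ℂ) : ℂ :=
  (n.factorial : ℂ)⁻¹ *
    ∑ σ : Fin (2 * k) → Equiv.Perm (Fin n),
      (∏ s, ((Equiv.Perm.sign (σ s) : ℤ) : ℂ)) * ∏ i, M (fun s => σ s i)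

/-- The Hankel tensor of order `2k` and dimension `n` with entries `B(a + |I|, b)`, where
`I = (i₁,…,i₂ₖ)` with `0 ≤ iₛ ≤ n - 1` and `|I| = i₁ + ⋯ + i₂ₖ`. Here `Complex.betaIntegral u v`
is Euler's integral `∫₀¹ x^(u-1) (1-x)^(v-1) dx`. -/
def selbergTensor (n k : ℕ) (a b : ℂ) (I : Fin (2 * k) → Fin n) : ℂ :=
  Complex.betaIntegral (a + ((∑ s, (I s : ℕ) : ℕ) : ℂ)) b

/-- The integrand `|Δ(x)|^(2k) ∏ᵢ xᵢ^(a-1) (1-xᵢ)^(b-1)` of Selberg's integral, with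
`Δ(x) = det (xᵢ^(j-1))` the Vandermonde determinant. -/
def selbergIntegrand (n k : ℕ) (a b : ℂ) (x : Fin n → ℝ) : ℂ :=
  ((|(Matrix.vandermonde x).det| ^ (2 * k) : ℝ) : ℂ) *
    ∏ i, ((x i : ℂ) ^ (a - 1) * (1 - (x i : ℂ)) ^ (b - 1))

/-- Selberg's integral `S_n(a,b;k)`, over the unit cube `[0,1]^n`. -/
def selbergIntegral (n k : ℕ) (a b : ℂ) : ℂ :=
  ∫ x in Set.Icc (0 : Fin n → ℝ) 1, selbergIntegrand n k a b x

end

/-! This is Selberg's own argument. Since 2k is even, |Δ|^(2k) = Δ^(2k) expands into signed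
monomials indexed by 2k-tuples of permutations. Integrating termwise gives products of Beta values,
and the sum of these is n! times the hyperdeterminant.

In every monomial the exponents, sorted increasingly, satisfy jk ≤ l_j ≤ (n+j-1)k. Hence ∏
Γ(a+jk)Γ(b)/Γ(a+b+(n+j-1)k) factors out of every term and leaves a cofactor R(a,b), polynomial in
each variable, of degree in b at most that of Q(b) = ∏ (b)_{jk}. The reflection x ↦ 1-x makes the
integral symmetric in a and b, that is, R(a,b)Q(a) = R(b,a)Q(b). By degrees R(a,b) = C·Q(b)
(`Polynomial.symmetric_rational_factor`), which is the Gamma product up to a constant.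

The constant is found by induction on n: for k > 0, t·S_{n+1}(t,1) tends to (n+1)·S_n(2k,1) as t →
0+ (`tendsto_mul_selbergIntegral_succ`), and the Gamma products on both sides are compared
(`selberg_constant_succ`). -/

open Filter Topology

/-! ### Termwise integration over tuples of permutations -/

/-- The product of the signs of a tuple of permutations. -/
noncomputable def tupleSign {n k : ℕ} (σ : Fin (2 * k) → Equiv.Perm (Fin n)) : ℂ :=
  ∏ s, ((Equiv.Perm.sign (σ s) : ℤ) : ℂ)

/-- The exponent of `xᵢ` in the monomial that a tuple of permutations contributes to
`Δ(x) ^ (2k)`. -/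
def tupleExponent {n k : ℕ} (σ : Fin (2 * k) → Equiv.Perm (Fin n)) (i : Fin n) : ℕ :=
  ∑ s, (σ s i : ℕ)

theorem factorial_mul_hyperdet_selbergTensor (n k : ℕ) (a b : ℂ) :
    (n.factorial : ℂ) * hyperdet (selbergTensor n k a b) =
      ∑ σ : Fin (2 * k) → Equiv.Perm (Fin n), tupleSign σ *
        ∏ i, Complex.betaIntegral (a + (tupleExponent σ i : ℂ)) b := by
  rw [hyperdet, mul_inv_cancel_left₀ (by exact_mod_cast n.factorial_ne_zero)]
  rfl

theorem vandermonde_det_pow_eq_sum {R : Type*} [CommRing R] {n : ℕ} (k : ℕ) (x : Fin n → R) :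
    (Matrix.vandermonde x).det ^ (2 * k) =
      ∑ σ : Fin (2 * k) → Equiv.Perm (Fin n),
        (∏ s, ((Equiv.Perm.sign (σ s) : ℤ) : R)) * ∏ i, x i ^ tupleExponent σ i := by
  rw [← Matrix.det_transpose, Matrix.det_apply', Finset.sum_pow', Fintype.piFinset_univ]
  refine Finset.sum_congr rfl fun σ _ => ?_
  rw [Finset.prod_mul_distrib, Finset.prod_comm]
  congr 1
  refine Finset.prod_congr rfl fun i _ => ?_
  simp [Matrix.vandermonde_apply, tupleExponent, Finset.prod_pow_eq_pow_sum]

theorem selbergIntegrand_eq_sum (n k : ℕ) (a b : ℂ) (x : Fin n → ℝ) :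
    selbergIntegrand n k a b x =
      ∑ σ : Fin (2 * k) → Equiv.Perm (Fin n), tupleSign σ *
        ∏ i, ((x i : ℂ) ^ tupleExponent σ i *
          ((x i : ℂ) ^ (a - 1) * (1 - (x i : ℂ)) ^ (b - 1))) := by
  have h : ((|(Matrix.vandermonde x).det| ^ (2 * k) : ℝ) : ℂ) =
      (Matrix.vandermonde fun i => (x i : ℂ)).det ^ (2 * k) := by
    rw [pow_mul, sq_abs, ← pow_mul]
    simp [Matrix.det_vandermonde]
  rw [selbergIntegrand, h, vandermonde_det_pow_eq_sum, Finset.sum_mul]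
  refine Finset.sum_congr rfl fun σ _ => ?_
  rw [mul_assoc, ← Finset.prod_mul_distrib]
  rfl

/-- The addition law for complex powers needs a nonzero base, so the null set {0} is discarded. -/
theorem pow_mul_betaIntegrand_ae_eq (m : ℕ) (a b : ℂ) :
    (fun x : ℝ => (x : ℂ) ^ m * ((x : ℂ) ^ (a - 1) * (1 - (x : ℂ)) ^ (b - 1)))
      =ᵐ[volume.restrict (Set.Icc 0 1)]
    fun x : ℝ => (x : ℂ) ^ (a + m - 1) * (1 - (x : ℂ)) ^ (b - 1) := by
  have h : ∀ᵐ x : ℝ ∂volume.restrict (Set.Icc 0 1), x ≠ 0 :=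
    Measure.ae_ne _ 0
  filter_upwards [h] with x hx
  have hx' : (x : ℂ) ≠ 0 := by exact_mod_cast hx
  rw [← mul_assoc, ← Complex.cpow_natCast, ← Complex.cpow_add _ _ hx']
  congr 2
  ring

theorem integrableOn_pow_mul_betaIntegrand (m : ℕ) {a b : ℂ} (ha : 0 < a.re) (hb : 0 < b.re) :
    Integrable (fun x : ℝ => (x : ℂ) ^ m * ((x : ℂ) ^ (a - 1) * (1 - (x : ℂ)) ^ (b - 1)))
      (volume.restrict (Set.Icc 0 1)) := by
  rw [integrable_congr (pow_mul_betaIntegrand_ae_eq m a b)]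
  have h := Complex.betaIntegral_convergent (u := a + m) (v := b)
    (by simp; positivity) hb
  exact ((intervalIntegrable_iff_integrableOn_Icc_of_le zero_le_one).1 h)

theorem integral_pow_mul_betaIntegrand (m : ℕ) (a b : ℂ) :
    ∫ x in Set.Icc (0 : ℝ) 1, (x : ℂ) ^ m * ((x : ℂ) ^ (a - 1) * (1 - (x : ℂ)) ^ (b - 1)) =
      Complex.betaIntegral (a + m) b := by
  rw [integral_congr_ae (pow_mul_betaIntegrand_ae_eq m a b), Complex.betaIntegral,
    intervalIntegral.integral_of_le zero_le_one, integral_Icc_eq_integral_Ioc]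

theorem volume_restrict_unitCube (n : ℕ) :
    (volume : Measure (Fin n → ℝ)).restrict (Set.Icc 0 1) =
      Measure.pi fun _ => volume.restrict (Set.Icc (0 : ℝ) 1) := by
  rw [← Measure.restrict_pi_pi, Set.pi_univ_Icc]
  rfl

theorem integrable_monomial_mul_betaIntegrand {n k : ℕ} {a b : ℂ} (ha : 0 < a.re) (hb : 0 < b.re)
    (σ : Fin (2 * k) → Equiv.Perm (Fin n)) :
    Integrable (fun x : Fin n → ℝ => tupleSign σ * ∏ i, ((x i : ℂ) ^ tupleExponent σ i *
        ((x i : ℂ) ^ (a - 1) * (1 - (x i : ℂ)) ^ (b - 1))))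
      (volume.restrict (Set.Icc 0 1)) := by
  rw [volume_restrict_unitCube]
  exact (Integrable.fintype_prod (f := fun i (t : ℝ) => (t : ℂ) ^ tupleExponent σ i *
    ((t : ℂ) ^ (a - 1) * (1 - (t : ℂ)) ^ (b - 1)))
    fun i => integrableOn_pow_mul_betaIntegrand _ ha hb).const_mul _

theorem integrableOn_selbergIntegrand (n k : ℕ) {a b : ℂ} (ha : 0 < a.re) (hb : 0 < b.re) :
    IntegrableOn (selbergIntegrand n k a b) (Set.Icc (0 : Fin n → ℝ) 1) := by
  simp only [IntegrableOn, funext (selbergIntegrand_eq_sum n k a b)]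
  exact integrable_finsetSum _ fun σ _ => integrable_monomial_mul_betaIntegrand ha hb σ

theorem selbergIntegral_eq_sum (n k : ℕ) {a b : ℂ} (ha : 0 < a.re) (hb : 0 < b.re) :
    selbergIntegral n k a b =
      ∑ σ : Fin (2 * k) → Equiv.Perm (Fin n), tupleSign σ *
        ∏ i, Complex.betaIntegral (a + (tupleExponent σ i : ℂ)) b := by
  simp only [selbergIntegral, selbergIntegrand_eq_sum]
  rw [integral_finsetSum _ fun σ _ => integrable_monomial_mul_betaIntegrand ha hb σ]
  refine Finset.sum_congr rfl fun σ _ => ?_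
  rw [integral_const_mul, volume_restrict_unitCube]
  congr 1
  rw [integral_fintype_prod_eq_prod (fun i (t : ℝ) => (t : ℂ) ^ tupleExponent σ i *
    ((t : ℂ) ^ (a - 1) * (1 - (t : ℂ)) ^ (b - 1)))]
  exact Finset.prod_congr rfl fun i _ => integral_pow_mul_betaIntegrand _ a b

/-! ### Symmetry in a and b under x ↦ 1 - x -/

theorem selbergIntegrand_one_sub (n k : ℕ) (a b : ℂ) (x : Fin n → ℝ) :
    selbergIntegrand n k a b (1 - x) = selbergIntegrand n k b a x := by
  have h : |(Matrix.vandermonde (1 - x)).det| = |(Matrix.vandermonde x).det| := by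
    simp only [Matrix.det_vandermonde, Finset.abs_prod, Pi.sub_apply, Pi.one_apply,
      sub_sub_sub_cancel_left]
    exact Finset.prod_congr rfl fun i _ => Finset.prod_congr rfl fun j _ => abs_sub_comm _ _
  rw [selbergIntegrand, h, selbergIntegrand]
  congr 1
  refine Finset.prod_congr rfl fun i _ => ?_
  simp [mul_comm]

theorem selbergIntegral_comm (n k : ℕ) (a b : ℂ) :
    selbergIntegral n k a b = selbergIntegral n k b a := by
  simp only [selbergIntegral, ← integral_indicator measurableSet_Icc]
  rw [← integral_sub_left_eq_self _ _ (1 : Fin n → ℝ)]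
  refine integral_congr_ae (Filter.Eventually.of_forall fun x => ?_)
  have h : (1 - x ∈ Set.Icc (0 : Fin n → ℝ) 1) ↔ x ∈ Set.Icc (0 : Fin n → ℝ) 1 := by
    simp [and_comm]
  by_cases hx : x ∈ Set.Icc (0 : Fin n → ℝ) 1
  · simp only [Set.indicator_of_mem hx, Set.indicator_of_mem (h.2 hx), selbergIntegrand_one_sub]
  · simp only [Set.indicator_of_notMem hx, Set.indicator_of_notMem (mt h.1 hx)]

/-! ### Bounds on the sorted exponents -/

theorem Finset.sum_range_card_id_le_sum (s : Finset ℕ) :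
    ∑ i ∈ Finset.range s.card, i ≤ ∑ i ∈ s, i := by
  have h := Finset.sum_range_le_sum (s := s.map Nat.castEmbedding) (c := 0) (by simp)
  simp only [zero_add, Finset.card_map, Finset.sum_map, Nat.castEmbedding_apply] at h
  rw [← Nat.cast_le (α := ℤ)]
  push_cast
  exact h

/-- Each of the 2k permutations takes distinct values on `T`, so it contributes at least 0 + 1 + ⋯ +
(|T| - 1). -/
theorem mul_card_le_sum_tupleExponent {n k : ℕ} (σ : Fin (2 * k) → Equiv.Perm (Fin n))
    (T : Finset (Fin n)) :
    k * (T.card * (T.card - 1)) ≤ ∑ i ∈ T, tupleExponent σ i := by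
  have h (s : Fin (2 * k)) : ∑ i ∈ Finset.range T.card, i ≤ ∑ i ∈ T, (σ s i : ℕ) := by
    have := Finset.sum_range_card_id_le_sum
      (T.map ((σ s).toEmbedding.trans Fin.valEmbedding))
    simpa using this
  simp only [tupleExponent]
  rw [Finset.sum_comm]
  refine le_trans (le_of_eq ?_) (Finset.sum_le_sum fun s _ => h s)
  rw [Finset.sum_const, Finset.card_univ, Fintype.card_fin, smul_eq_mul,
    ← Finset.sum_range_id_mul_two]
  ring

theorem sum_tupleExponent {n k : ℕ} (σ : Fin (2 * k) → Equiv.Perm (Fin n)) :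
    ∑ i, tupleExponent σ i = k * (n * (n - 1)) := by
  simp only [tupleExponent]
  rw [Finset.sum_comm]
  have h (s : Fin (2 * k)) : ∑ i, (σ s i : ℕ) = ∑ i ∈ Finset.range n, i := by
    rw [Equiv.sum_comp (σ s) (fun i => (i : ℕ)), Fin.sum_univ_eq_sum_range (fun i => i)]
  simp only [h, Finset.sum_const, Finset.card_univ, Fintype.card_fin, smul_eq_mul,
    ← Finset.sum_range_id_mul_two]
  ring

/-- The permutation that puts the exponents of a tuple in increasing order. -/
def exponentSort {n k : ℕ} (σ : Fin (2 * k) → Equiv.Perm (Fin n)) : Equiv.Perm (Fin n) :=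
  Tuple.sort (tupleExponent σ)

/-- The j + 1 smallest exponents sum to at least k(j+1)j, and their maximum is at least their
average. -/
theorem mul_le_tupleExponent_sort {n k : ℕ} (σ : Fin (2 * k) → Equiv.Perm (Fin n)) (j : Fin n) :
    j * k ≤ tupleExponent σ (exponentSort σ j) := by
  have hm : Monotone (tupleExponent σ ∘ exponentSort σ) := Tuple.monotone_sort _
  have h1 := mul_card_le_sum_tupleExponent σ ((Finset.Iic j).map (exponentSort σ).toEmbedding)
  rw [Finset.sum_map] at h1
  have h2 : ∑ i ∈ Finset.Iic j, tupleExponent σ (exponentSort σ i) ≤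
      (Finset.Iic j).card • tupleExponent σ (exponentSort σ j) :=
    Finset.sum_le_card_nsmul _ _ _ fun i hi => hm (Finset.mem_Iic.1 hi)
  have h3 := h1.trans h2
  simp only [Finset.card_map, Fin.card_Iic, Nat.add_sub_cancel, smul_eq_mul] at h3
  refine le_of_mul_le_mul_left (a := (j : ℕ) + 1) ?_ (Nat.succ_pos _)
  linarith

/-- The j smallest exponents sum to at least kj(j-1), out of a total of kn(n-1). The other n - j
then sum to at most k(n-j)(n+j-1), and their minimum is at most their average. -/
theorem tupleExponent_sort_le {n k : ℕ} (σ : Fin (2 * k) → Equiv.Perm (Fin n)) (j : Fin n) :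
    tupleExponent σ (exponentSort σ j) ≤ (n + j - 1) * k := by
  have hm : Monotone (tupleExponent σ ∘ exponentSort σ) := Tuple.monotone_sort _
  have h1 := mul_card_le_sum_tupleExponent σ ((Finset.Iio j).map (exponentSort σ).toEmbedding)
  rw [Finset.sum_map] at h1
  have h2 : (Finset.Ici j).card • tupleExponent σ (exponentSort σ j) ≤
      ∑ i ∈ Finset.Ici j, tupleExponent σ (exponentSort σ i) :=
    Finset.card_nsmul_le_sum _ _ _ fun i hi => hm (Finset.mem_Ici.1 hi)
  have h3 : ∑ i ∈ Finset.Iio j, tupleExponent σ (exponentSort σ i) +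
      ∑ i ∈ Finset.Ici j, tupleExponent σ (exponentSort σ i) = k * (n * (n - 1)) := by
    rw [← sum_tupleExponent σ, ← Equiv.sum_comp (exponentSort σ) (tupleExponent σ),
      ← Finset.sum_filter_add_sum_filter_not Finset.univ (· < j)]
    congr 2 <;> ext <;> simp
  simp only [Finset.card_map, Fin.card_Iio, Fin.card_Ici, smul_eq_mul] at h1 h2
  -- Writing n = j + d + 1 removes the truncated subtractions in n; the one in j - 1 forces the case
  -- split on j = 0 below.
  obtain ⟨d, hd⟩ : ∃ d, n = j + d + 1 := ⟨n - j - 1, by omega⟩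
  have e1 : n - (j : ℕ) = d + 1 := by omega
  have e2 : n - 1 = (j : ℕ) + d := by omega
  have e3 : n + (j : ℕ) - 1 = 2 * j + d := by omega
  rw [e1] at h2
  rw [e2] at h3
  rw [e3]
  change _ ≤ ∑ i ∈ Finset.Iio j, tupleExponent σ (exponentSort σ i) at h1
  have h4 : k * (j * (j - 1)) + (d + 1) * tupleExponent σ (exponentSort σ j) ≤
      k * ((j + d + 1) * (j + d)) := by
    have : k * (n * (j + d)) = k * ((j + d + 1) * (j + d)) := by
      rw [← hd]
    linarith
  refine le_of_mul_le_mul_left (a := d + 1) ?_ (Nat.succ_pos _)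
  rcases Nat.eq_zero_or_pos (j : ℕ) with h0 | h0
  · rw [h0] at h4 ⊢
    nlinarith
  · obtain ⟨m, hm⟩ : ∃ m, (j : ℕ) = m + 1 := ⟨j - 1, by omega⟩
    rw [hm] at h4 ⊢
    simp only [Nat.add_sub_cancel] at h4
    nlinarith

/-! ### The polynomial cofactor and its determination up to a constant -/

theorem Complex.Gamma_add_natCast_eq_ascPochhammer {z : ℂ} (hz : 0 < z.re) (m : ℕ) :
    Complex.Gamma (z + m) = (ascPochhammer ℂ m).eval z * Complex.Gamma z := by
  rw [← Complex.Gamma_add_nat_div_Gamma_eq z,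
    div_mul_cancel₀ _ (Complex.Gamma_ne_zero_of_re_pos hz)]
  rintro m rfl
  simp at hz
  linarith [(Nat.cast_nonneg m : (0 : ℝ) ≤ m)]

/-- For fixed b, symmetry reads Q(b)·R(b,a) = R(a,b)·Q(a), an identity of polynomials in a. The left
side has degree at most deg Q, so R(·,b) is constant; symmetry at a = 1 then yields the dependence
on b. -/
theorem Polynomial.symmetric_rational_factor {R : ℂ → ℂ → ℂ} {Q : Polynomial ℂ}
    (hQ : ∀ z : ℂ, 0 < z.re → Q.eval z ≠ 0)
    (hleft : ∀ b, ∃ q : Polynomial ℂ, ∀ a, R a b = q.eval a)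
    (hright : ∀ a, ∃ p : Polynomial ℂ, p.natDegree ≤ Q.natDegree ∧ ∀ b, R a b = p.eval b)
    (hsymm : ∀ a b : ℂ, 0 < a.re → 0 < b.re → R a b * Q.eval a = R b a * Q.eval b) :
    ∃ C : ℂ, ∀ a b : ℂ, 0 < a.re → 0 < b.re → R a b = C * Q.eval b := by
  have hinf : {z : ℂ | 0 < z.re}.Infinite := by
    refine Set.infinite_of_injective_forall_mem (f := fun n : ℕ => (n : ℂ) + 1) ?_ ?_
    · intro m n h
      simpa using h
    · intro n
      simp only [Set.mem_ofPred_eq, Complex.add_re, Complex.natCast_re, Complex.one_re]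
      positivity
  have hconst (a b : ℂ) (hb : 0 < b.re) : R a b = R 1 b := by
    obtain ⟨q, hq⟩ := hleft b
    obtain ⟨p, hpd, hp⟩ := hright b
    have hpoly : Polynomial.C (Q.eval b) * p = q * Q := by
      refine Polynomial.eq_of_infinite_eval_eq _ _ (hinf.mono fun z hz => ?_)
      have := hsymm z b hz hb
      simp only [Set.mem_ofPred_eq, Polynomial.eval_mul, Polynomial.eval_C, ← hp, ← hq]
      rw [this, mul_comm]
    have hq0 : q.natDegree = 0 := by
      by_cases h0 : q = 0
      · simp [h0]
      have hQ0 : Q ≠ 0 := by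
        rintro rfl
        exact hQ 1 (by simp) (by simp)
      have h1 := Polynomial.natDegree_mul h0 hQ0
      have h2 := Polynomial.natDegree_C_mul_le (Q.eval b) p
      rw [hpoly] at h2
      omega
    rw [hq, hq, Polynomial.eq_C_of_natDegree_eq_zero hq0]
    simp
  refine ⟨R 1 1 / Q.eval 1, fun a b ha hb => ?_⟩
  have h1 : (0 : ℝ) < (1 : ℂ).re := by simp
  have h := hsymm 1 b h1 hb
  rw [hconst b 1 h1] at h
  rw [hconst a b hb, div_mul_eq_mul_div, eq_div_iff (hQ 1 h1), h]

theorem Complex.re_add_natCast_pos {z : ℂ} (hz : 0 < z.re) (m : ℕ) : 0 < (z + m).re := by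
  simp only [Complex.add_re, Complex.natCast_re]
  positivity

/-- In Γ(a+l)Γ(b)/Γ(a+b+l), the numerator is reached from Γ(a+m) and the denominator from Γ(a+b+N),
each at the cost of a Pochhammer polynomial. -/
theorem Complex.betaIntegral_add_natCast {a b : ℂ} (ha : 0 < a.re) (hb : 0 < b.re) {m l N : ℕ}
    (hm : m ≤ l) (hN : l ≤ N) :
    Complex.betaIntegral (a + l) b =
      Complex.Gamma (a + m) * Complex.Gamma b / Complex.Gamma (a + b + N) *
        ((ascPochhammer ℂ (l - m)).eval (a + m) * (ascPochhammer ℂ (N - l)).eval (a + b + l)) := by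
  have hab : 0 < (a + b).re := by simp only [Complex.add_re]; positivity
  have h1 : Complex.Gamma (a + l) =
      (ascPochhammer ℂ (l - m)).eval (a + m) * Complex.Gamma (a + m) := by
    rw [← Complex.Gamma_add_natCast_eq_ascPochhammer (Complex.re_add_natCast_pos ha m),
      Nat.cast_sub hm]
    congr 1; ring
  have h2 : Complex.Gamma (a + b + N) =
      (ascPochhammer ℂ (N - l)).eval (a + b + l) * Complex.Gamma (a + b + l) := by
    rw [← Complex.Gamma_add_natCast_eq_ascPochhammer (Complex.re_add_natCast_pos hab l),
      Nat.cast_sub hN]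
    congr 1; ring
  have h3 : Complex.Gamma (a + b + N) ≠ 0 :=
    Complex.Gamma_ne_zero_of_re_pos (Complex.re_add_natCast_pos hab N)
  rw [Complex.betaIntegral_eq_Gamma_mul_div _ _ (Complex.re_add_natCast_pos ha l) hb, h1,
    show a + l + b = a + b + l by ring]
  rw [h2] at h3 ⊢
  have h4 := right_ne_zero_of_mul h3
  have h5 := left_ne_zero_of_mul h3
  field_simp

/-- The polynomial cofactor of Selberg's integral: its quotient by
`∏ⱼ Γ(a + jk) Γ(b) / Γ(a + b + (n + j - 1)k)`. -/
noncomputable def selbergCofactor (n k : ℕ) (a b : ℂ) : ℂ :=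
  ∑ σ : Fin (2 * k) → Equiv.Perm (Fin n), tupleSign σ *
    ∏ j : Fin n,
      ((ascPochhammer ℂ (tupleExponent σ (exponentSort σ j) - j * k)).eval
          (a + ((j * k : ℕ) : ℂ)) *
        (ascPochhammer ℂ ((n + j - 1) * k - tupleExponent σ (exponentSort σ j))).eval
          (a + b + (tupleExponent σ (exponentSort σ j) : ℂ)))

/-- The polynomial `∏ⱼ (z)_{jk}`, a product of Pochhammer symbols. -/
noncomputable def pochhammerProd (n k : ℕ) : Polynomial ℂ := ∏ j : Fin n, ascPochhammer ℂ (j * k)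

theorem natDegree_pochhammerProd (n k : ℕ) :
    (pochhammerProd n k).natDegree = ∑ j : Fin n, (j : ℕ) * k := by
  rw [pochhammerProd, Polynomial.natDegree_prod_of_monic _ _ fun j _ => monic_ascPochhammer ℂ _]
  simp

theorem selbergIntegral_eq_cofactor (n k : ℕ) {a b : ℂ} (ha : 0 < a.re) (hb : 0 < b.re) :
    selbergIntegral n k a b =
      (∏ j : Fin n, Complex.Gamma (a + ((j * k : ℕ) : ℂ)) * Complex.Gamma b /
        Complex.Gamma (a + b + (((n + j - 1) * k : ℕ) : ℂ))) * selbergCofactor n k a b := by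
  rw [selbergIntegral_eq_sum n k ha hb, selbergCofactor, Finset.mul_sum]
  refine Finset.sum_congr rfl fun σ _ => ?_
  rw [mul_left_comm, ← Finset.prod_mul_distrib, ← Equiv.prod_comp (exponentSort σ)]
  congr 1
  exact Finset.prod_congr rfl fun j _ => Complex.betaIntegral_add_natCast ha hb
    (mul_le_tupleExponent_sort σ j) (tupleExponent_sort_le σ j)

theorem selbergCofactor_eq_eval_left (n k : ℕ) (b : ℂ) :
    ∃ q : Polynomial ℂ, ∀ a, selbergCofactor n k a b = q.eval a := by
  refine ⟨∑ σ : Fin (2 * k) → Equiv.Perm (Fin n), Polynomial.C (tupleSign σ) *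
    ∏ j : Fin n,
      ((ascPochhammer ℂ (tupleExponent σ (exponentSort σ j) - j * k)).comp
          (Polynomial.X + Polynomial.C ((j * k : ℕ) : ℂ)) *
        (ascPochhammer ℂ ((n + j - 1) * k - tupleExponent σ (exponentSort σ j))).comp
          (Polynomial.X + Polynomial.C b +
            Polynomial.C (tupleExponent σ (exponentSort σ j) : ℂ))), fun a => ?_⟩
  simp [selbergCofactor, Polynomial.eval_finsetSum, Polynomial.eval_prod]

/-- This is the degree in b of one term of the cofactor. It equals deg Q exactly, since (n+j-1)k
exceeds jk by (n-1)k and the exponents sum to kn(n-1). -/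
theorem sum_sub_tupleExponent_sort {n k : ℕ} (σ : Fin (2 * k) → Equiv.Perm (Fin n)) :
    ∑ j : Fin n, ((n + j - 1) * k - tupleExponent σ (exponentSort σ j)) =
      ∑ j : Fin n, (j : ℕ) * k := by
  have h1 : ∑ j, tupleExponent σ (exponentSort σ j) = k * (n * (n - 1)) := by
    rw [Equiv.sum_comp (exponentSort σ) (tupleExponent σ), sum_tupleExponent]
  have h2 : ∑ j : Fin n, ((n + j - 1) * k - tupleExponent σ (exponentSort σ j)) +
      ∑ j, tupleExponent σ (exponentSort σ j) = ∑ j : Fin n, (n + j - 1) * k := by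
    rw [← Finset.sum_add_distrib]
    exact Finset.sum_congr rfl fun j _ => Nat.sub_add_cancel (tupleExponent_sort_le σ j)
  have h3 : ∑ j : Fin n, (n + j - 1) * k = ∑ j : Fin n, (j : ℕ) * k + k * (n * (n - 1)) := by
    have h (j : Fin n) : (n + j - 1) * k = j * k + (n - 1) * k := by
      rw [← add_mul]
      congr 1
      have := j.2
      omega
    simp only [h, Finset.sum_add_distrib, Finset.sum_const, Finset.card_univ, Fintype.card_fin,
      smul_eq_mul]
    ring
  omega

theorem selbergCofactor_eq_eval_right (n k : ℕ) (a : ℂ) :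
    ∃ p : Polynomial ℂ, p.natDegree ≤ (pochhammerProd n k).natDegree ∧
      ∀ b, selbergCofactor n k a b = p.eval b := by
  refine ⟨∑ σ : Fin (2 * k) → Equiv.Perm (Fin n), Polynomial.C (tupleSign σ) *
    ∏ j : Fin n,
      (Polynomial.C ((ascPochhammer ℂ (tupleExponent σ (exponentSort σ j) - j * k)).eval
          (a + ((j * k : ℕ) : ℂ))) *
        (ascPochhammer ℂ ((n + j - 1) * k - tupleExponent σ (exponentSort σ j))).comp
          (Polynomial.X + Polynomial.C (a +
            (tupleExponent σ (exponentSort σ j) : ℂ)))), ?_, fun b => ?_⟩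
  · refine Polynomial.natDegree_sum_le_of_forall_le _ _ fun σ _ => ?_
    refine (Polynomial.natDegree_C_mul_le _ _).trans ((Polynomial.natDegree_prod_le _ _).trans ?_)
    rw [natDegree_pochhammerProd, ← sum_sub_tupleExponent_sort σ]
    refine Finset.sum_le_sum fun j _ => (Polynomial.natDegree_C_mul_le _ _).trans ?_
    rw [Polynomial.natDegree_comp, ascPochhammer_natDegree, Polynomial.natDegree_X_add_C, mul_one]
  · simp [selbergCofactor, Polynomial.eval_finsetSum, Polynomial.eval_prod, add_left_comm b a,
      add_assoc]

theorem prod_Gamma_add_natCast (n k : ℕ) {z : ℂ} (hz : 0 < z.re) :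
    ∏ j : Fin n, Complex.Gamma (z + ((j * k : ℕ) : ℂ)) =
      (pochhammerProd n k).eval z * Complex.Gamma z ^ n := by
  simp only [Complex.Gamma_add_natCast_eq_ascPochhammer hz, Finset.prod_mul_distrib,
    pochhammerProd, Polynomial.eval_prod, Finset.prod_const, Finset.card_univ, Fintype.card_fin]

theorem pochhammerProd_eval_ne_zero (n k : ℕ) {z : ℂ} (hz : 0 < z.re) :
    (pochhammerProd n k).eval z ≠ 0 := by
  have h : ∏ j : Fin n, Complex.Gamma (z + ((j * k : ℕ) : ℂ)) ≠ 0 :=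
    Finset.prod_ne_zero_iff.2 fun j _ =>
      Complex.Gamma_ne_zero_of_re_pos (Complex.re_add_natCast_pos hz _)
  rw [prod_Gamma_add_natCast n k hz] at h
  exact left_ne_zero_of_mul h

theorem selbergCofactor_symm (n k : ℕ) {a b : ℂ} (ha : 0 < a.re) (hb : 0 < b.re) :
    selbergCofactor n k a b * (pochhammerProd n k).eval a =
      selbergCofactor n k b a * (pochhammerProd n k).eval b := by
  have h := selbergIntegral_comm n k a b
  have hab : 0 < (a + b).re := by simp only [Complex.add_re]; positivity
  rw [selbergIntegral_eq_cofactor n k ha hb, selbergIntegral_eq_cofactor n k hb ha] at h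
  simp only [Finset.prod_div_distrib, Finset.prod_mul_distrib, prod_Gamma_add_natCast n k ha,
    prod_Gamma_add_natCast n k hb, Finset.prod_const, Finset.card_univ, Fintype.card_fin,
    add_comm b a] at h
  have h1 : ∏ j : Fin n, Complex.Gamma (a + b + (((n + j - 1) * k : ℕ) : ℂ)) ≠ 0 :=
    Finset.prod_ne_zero_iff.2 fun j _ =>
      Complex.Gamma_ne_zero_of_re_pos (Complex.re_add_natCast_pos hab _)
  have h2 : Complex.Gamma a ^ n ≠ 0 := pow_ne_zero _ (Complex.Gamma_ne_zero_of_re_pos ha)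
  have h3 : Complex.Gamma b ^ n ≠ 0 := pow_ne_zero _ (Complex.Gamma_ne_zero_of_re_pos hb)
  field_simp at h
  linear_combination h

/-- The Gamma function product `∏ⱼ Γ(a + jk) Γ(b + jk) / Γ(a + b + (n + j - 1)k)`. -/
noncomputable def selbergGammaProd (n k : ℕ) (a b : ℂ) : ℂ :=
  ∏ j ∈ Finset.range n,
    Complex.Gamma (a + (j : ℂ) * k) * Complex.Gamma (b + (j : ℂ) * k) /
      Complex.Gamma (a + b + ((n : ℂ) + j - 1) * k)

theorem exists_selbergIntegral_eq_mul (n k : ℕ) :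
    ∃ C : ℂ, ∀ a b : ℂ, 0 < a.re → 0 < b.re →
      selbergIntegral n k a b = C * selbergGammaProd n k a b := by
  obtain ⟨C, hC⟩ := Polynomial.symmetric_rational_factor
    (fun z hz => pochhammerProd_eval_ne_zero n k hz)
    (selbergCofactor_eq_eval_left n k) (selbergCofactor_eq_eval_right n k)
    (fun a b ha hb => selbergCofactor_symm n k ha hb)
  refine ⟨C, fun a b ha hb => ?_⟩
  have h : selbergGammaProd n k a b = ∏ j : Fin n,
      Complex.Gamma (a + ((j * k : ℕ) : ℂ)) * Complex.Gamma (b + ((j * k : ℕ) : ℂ)) /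
        Complex.Gamma (a + b + (((n + j - 1) * k : ℕ) : ℂ)) := by
    rw [selbergGammaProd, Finset.prod_range]
    refine Finset.prod_congr rfl fun j _ => ?_
    have hj : 1 ≤ n + (j : ℕ) := by have := j.2; omega
    push_cast [Nat.cast_sub hj]
    rfl
  -- The factor Q(b) turns Γ(b)^n into ∏ Γ(b+jk).
  rw [selbergIntegral_eq_cofactor n k ha hb, hC a b ha hb, h]
  simp only [Finset.prod_div_distrib, Finset.prod_mul_distrib, prod_Gamma_add_natCast n k hb,
    Finset.prod_const, Finset.card_univ, Fintype.card_fin]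
  ring

/-! ### Recursion for the constant from the pole at a = 0 -/

theorem tupleExponent_mul_right {n k : ℕ} (σ : Fin (2 * k) → Equiv.Perm (Fin n))
    (π : Equiv.Perm (Fin n)) :
    tupleExponent (fun s => σ s * π) = tupleExponent σ ∘ π := rfl

theorem tupleSign_mul_right {n k : ℕ} (σ : Fin (2 * k) → Equiv.Perm (Fin n))
    (π : Equiv.Perm (Fin n)) :
    tupleSign (fun s => σ s * π) = tupleSign σ := by
  have h : ((Equiv.Perm.sign π : ℤ) : ℂ) ^ (2 * k) = 1 := by
    rw [pow_mul]
    norm_cast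
    simp
  simp only [tupleSign, Equiv.Perm.sign_mul, Units.val_mul, Int.cast_mul, Finset.prod_mul_distrib,
    Finset.prod_const, Finset.card_univ, Fintype.card_fin, h, mul_one]

/-- Right multiplication of the whole tuple by π permutes the exponents, and changes the sign by
ε(π)^(2k) = 1. -/
theorem sum_tuple_comp_perm {n k : ℕ} (g : (Fin n → ℕ) → ℂ) (π : Equiv.Perm (Fin n)) :
    ∑ σ : Fin (2 * k) → Equiv.Perm (Fin n), tupleSign σ * g (tupleExponent σ ∘ π) =
      ∑ σ : Fin (2 * k) → Equiv.Perm (Fin n), tupleSign σ * g (tupleExponent σ) := by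
  refine Fintype.sum_equiv (Equiv.piCongrRight fun _ => Equiv.mulRight π) _ _ fun σ => ?_
  change _ = tupleSign (fun s => σ s * π) * g (tupleExponent fun s => σ s * π)
  rw [tupleExponent_mul_right, tupleSign_mul_right]

/-- Extend every permutation of a tuple to one dimension more, fixing the new index `0`. -/
def tupleLift {n k : ℕ} (e : Fin (2 * k) → Equiv.Perm (Fin n)) :
    Fin (2 * k) → Equiv.Perm (Fin (n + 1)) :=
  fun s => Equiv.Perm.decomposeFin.symm (0, e s)

theorem tupleSign_tupleLift {n k : ℕ} (e : Fin (2 * k) → Equiv.Perm (Fin n)) :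
    tupleSign (tupleLift e) = tupleSign e := by
  simp [tupleSign, tupleLift, Equiv.Perm.decomposeFin.symm_sign]

theorem tupleExponent_tupleLift_zero {n k : ℕ} (e : Fin (2 * k) → Equiv.Perm (Fin n)) :
    tupleExponent (tupleLift e) 0 = 0 := by
  simp [tupleExponent, tupleLift]

theorem tupleExponent_tupleLift_succ {n k : ℕ} (e : Fin (2 * k) → Equiv.Perm (Fin n)) (m : Fin n) :
    tupleExponent (tupleLift e) m.succ = 2 * k + tupleExponent e m := by
  simp [tupleExponent, tupleLift, Finset.sum_add_distrib, add_comm]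

theorem tupleLift_injective {n k : ℕ} :
    Function.Injective (tupleLift : (Fin (2 * k) → Equiv.Perm (Fin n)) → _) := by
  intro e e' h
  funext s
  have := Equiv.Perm.decomposeFin.symm.injective (congrFun h s)
  exact (Prod.ext_iff.1 this).2

theorem exists_tupleLift_eq {n k : ℕ} {σ : Fin (2 * k) → Equiv.Perm (Fin (n + 1))}
    (h : tupleExponent σ 0 = 0) : ∃ e, tupleLift e = σ := by
  refine ⟨fun s => (Equiv.Perm.decomposeFin (σ s)).2, funext fun s => ?_⟩
  have h0 : σ s 0 = 0 := by
    have := Finset.sum_eq_zero_iff.1 h s (Finset.mem_univ s)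
    exact Fin.ext (by simpa using this)
  have h1 : (Equiv.Perm.decomposeFin (σ s)).1 = 0 := by
    have := Equiv.Perm.decomposeFin_symm_apply_zero (Equiv.Perm.decomposeFin (σ s)).1
      (Equiv.Perm.decomposeFin (σ s)).2
    rw [Prod.mk.eta, Equiv.symm_apply_apply, h0] at this
    exact this.symm
  rw [tupleLift, ← h1, Prod.mk.eta, Equiv.symm_apply_apply]

/-- The residue at `t = 0` of `∏ᵢ 1 / (t + lᵢ)` when only `l₀` vanishes. -/
noncomputable def headResidue {n : ℕ} (l : Fin (n + 1) → ℕ) : ℂ :=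
  if l 0 = 0 then ∏ m : Fin n, 1 / (l m.succ : ℂ) else 0

/-- Only tuples all of whose permutations fix 0 survive. They are lifts from one dimension less, and
the lift raises each remaining exponent by 1 per permutation, hence by 2k. -/
theorem sum_tuple_headResidue {n k : ℕ} :
    ∑ σ : Fin (2 * k) → Equiv.Perm (Fin (n + 1)), tupleSign σ * headResidue (tupleExponent σ) =
      ∑ e : Fin (2 * k) → Equiv.Perm (Fin n), tupleSign e *
        ∏ m, 1 / ((2 * k : ℂ) + tupleExponent e m) := by
  refine (Finset.sum_of_injOn tupleLift tupleLift_injective.injOn (by simp) ?_ ?_).symm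
  · intro σ _ hσ
    rw [headResidue, if_neg, mul_zero]
    intro h
    obtain ⟨e, rfl⟩ := exists_tupleLift_eq h
    exact hσ ⟨e, by simp, rfl⟩
  · intro e _
    simp only [headResidue, tupleExponent_tupleLift_zero, if_true, tupleSign_tupleLift,
      tupleExponent_tupleLift_succ]
    push_cast
    rfl

theorem tendsto_ofReal_nhdsGT_zero : Tendsto (fun t : ℝ => (t : ℂ)) (𝓝[>] 0) (𝓝 0) := by
  have h : Tendsto (fun t : ℝ => (t : ℂ)) (𝓝 0) (𝓝 ((0 : ℝ) : ℂ)) :=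
    Complex.continuous_ofReal.tendsto 0
  rw [Complex.ofReal_zero] at h
  exact h.mono_left nhdsWithin_le_nhds

theorem tendsto_one_div_add_natCast {m : ℕ} (hm : m ≠ 0) :
    Tendsto (fun t : ℝ => 1 / ((t : ℂ) + m)) (𝓝[>] 0) (𝓝 (1 / (m : ℂ))) := by
  have h := (tendsto_ofReal_nhdsGT_zero.add_const (m : ℂ))
  rw [zero_add] at h
  exact tendsto_const_nhds.div h (by exact_mod_cast hm)

/-- At most one `l i` vanishes, so the pole is at most simple. The sum over swaps records which
index carries it: at most one summand is nonzero. -/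
theorem tendsto_mul_prod_one_div {n : ℕ} {l : Fin (n + 1) → ℕ}
    (hl : ∀ i j, l i = 0 → l j = 0 → i = j) :
    Tendsto (fun t : ℝ => (t : ℂ) * ∏ i, 1 / ((t : ℂ) + l i)) (𝓝[>] 0)
      (𝓝 (∑ i, headResidue (l ∘ Equiv.swap 0 i))) := by
  by_cases h : ∃ i, l i = 0
  · obtain ⟨i, hi⟩ := h
    have hsum : ∑ i', headResidue (l ∘ Equiv.swap 0 i') =
        ∏ m : Fin n, 1 / (l (Equiv.swap 0 i m.succ) : ℂ) := by
      rw [Finset.sum_eq_single i]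
      · simp [headResidue, hi]
      · intro j _ hj
        rw [headResidue, if_neg]
        intro h0
        exact hj (hl _ _ (by simpa using h0) hi)
      · simp
    rw [hsum]
    have hlim : Tendsto (fun t : ℝ => ∏ m : Fin n, 1 / ((t : ℂ) + l (Equiv.swap 0 i m.succ)))
        (𝓝[>] 0) (𝓝 (∏ m : Fin n, 1 / (l (Equiv.swap 0 i m.succ) : ℂ))) := by
      refine tendsto_finsetProd _ fun m _ => tendsto_one_div_add_natCast fun h0 => ?_
      have h1 := hl _ _ h0 hi
      rw [Equiv.swap_apply_eq_iff, Equiv.swap_apply_right] at h1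
      exact Fin.succ_ne_zero m h1
    refine hlim.congr' ?_
    filter_upwards [self_mem_nhdsWithin] with t ht
    have ht' : (t : ℂ) ≠ 0 := by exact_mod_cast (ne_of_gt ht)
    rw [← Equiv.prod_comp (Equiv.swap 0 i), Fin.prod_univ_succ, Equiv.swap_apply_left, hi,
      Nat.cast_zero, add_zero, ← mul_assoc, mul_one_div_cancel ht', one_mul]
  · push Not at h
    have hsum : ∑ i, headResidue (l ∘ Equiv.swap 0 i) = 0 :=
      Finset.sum_eq_zero fun i _ => by simp [headResidue, h]
    rw [hsum, ← zero_mul (∏ i, 1 / (l i : ℂ))]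
    exact tendsto_ofReal_nhdsGT_zero.mul
      (tendsto_finsetProd _ fun i _ => tendsto_one_div_add_natCast (h i))

theorem tupleExponent_eq_zero_unique {n k : ℕ} (hk : 0 < k)
    (σ : Fin (2 * k) → Equiv.Perm (Fin n)) (i j : Fin n)
    (hi : tupleExponent σ i = 0) (hj : tupleExponent σ j = 0) : i = j := by
  let s : Fin (2 * k) := ⟨0, by omega⟩
  have h1 := Finset.sum_eq_zero_iff.1 hi s (Finset.mem_univ s)
  have h2 := Finset.sum_eq_zero_iff.1 hj s (Finset.mem_univ s)
  exact (σ s).injective (Fin.ext (h1.trans h2.symm))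

theorem selbergIntegral_one_right (n k : ℕ) {a : ℂ} (ha : 0 < a.re) :
    selbergIntegral n k a 1 =
      ∑ σ : Fin (2 * k) → Equiv.Perm (Fin n), tupleSign σ *
        ∏ i, 1 / (a + (tupleExponent σ i : ℂ)) := by
  rw [selbergIntegral_eq_sum n k ha (by simp)]
  simp only [Complex.betaIntegral_eval_one_right (Complex.re_add_natCast_pos ha _)]

/-- Each of the n + 1 possible positions of the vanishing exponent contributes equally after
relabelling, whence the factor n + 1. The shift of the exponents by 2k becomes the new first
argument. -/
theorem tendsto_mul_selbergIntegral_succ (n : ℕ) {k : ℕ} (hk : 0 < k) :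
    Tendsto (fun t : ℝ => (t : ℂ) * selbergIntegral (n + 1) k t 1) (𝓝[>] 0)
      (𝓝 (((n : ℂ) + 1) * selbergIntegral n k (2 * k) 1)) := by
  have hlim : Tendsto (fun t : ℝ => ∑ σ : Fin (2 * k) → Equiv.Perm (Fin (n + 1)), tupleSign σ *
      ((t : ℂ) * ∏ i, 1 / ((t : ℂ) + (tupleExponent σ i : ℂ)))) (𝓝[>] 0)
      (𝓝 (∑ σ : Fin (2 * k) → Equiv.Perm (Fin (n + 1)), tupleSign σ *
        ∑ i, headResidue (tupleExponent σ ∘ Equiv.swap 0 i))) :=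
    tendsto_finsetSum _ fun σ _ => (tendsto_mul_prod_one_div
      (tupleExponent_eq_zero_unique hk σ)).const_mul _
  have hval : ∑ σ : Fin (2 * k) → Equiv.Perm (Fin (n + 1)), tupleSign σ *
      ∑ i, headResidue (tupleExponent σ ∘ Equiv.swap 0 i) =
      ((n : ℂ) + 1) * selbergIntegral n k (2 * k) 1 := by
    simp only [Finset.mul_sum]
    rw [Finset.sum_comm]
    simp only [sum_tuple_comp_perm headResidue, sum_tuple_headResidue]
    rw [selbergIntegral_one_right n k (by simpa using hk)]
    simp
  rw [hval] at hlim
  refine hlim.congr' ?_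
  filter_upwards [self_mem_nhdsWithin] with t ht
  rw [selbergIntegral_one_right _ _ (by simpa using ht), Finset.mul_sum]
  exact Finset.sum_congr rfl fun σ _ => mul_left_comm _ _ _

theorem tendsto_Gamma_add_ofReal {z : ℂ} (hz : 0 < z.re) :
    Tendsto (fun t : ℝ => Complex.Gamma (t + z)) (𝓝[>] 0) (𝓝 (Complex.Gamma z)) := by
  have hc : ContinuousAt Complex.Gamma z := by
    refine (Complex.differentiableAt_Gamma z ?_).continuousAt
    rintro m rfl
    simp at hz
    linarith [(Nat.cast_nonneg m : (0 : ℝ) ≤ m)]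
  have h := tendsto_ofReal_nhdsGT_zero.add_const z
  rw [zero_add] at h
  exact hc.tendsto.comp h

theorem tendsto_mul_Gamma_ofReal :
    Tendsto (fun t : ℝ => (t : ℂ) * Complex.Gamma t) (𝓝[>] 0) (𝓝 1) := by
  refine Complex.tendsto_self_mul_Gamma_nhds_zero.comp
    (tendsto_nhdsWithin_iff.2 ⟨tendsto_ofReal_nhdsGT_zero, ?_⟩)
  filter_upwards [self_mem_nhdsWithin] with t ht
  exact Complex.ofReal_ne_zero.2 (ne_of_gt ht)

theorem tendsto_mul_selbergGammaProd_succ (n : ℕ) {k : ℕ} (hk : 0 < k) :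
    Tendsto (fun t : ℝ => (t : ℂ) * selbergGammaProd (n + 1) k t 1) (𝓝[>] 0)
      (𝓝 (1 / Complex.Gamma (1 + (n : ℂ) * k) * ∏ j ∈ Finset.range n,
        (Complex.Gamma (((j : ℂ) + 1) * k) * Complex.Gamma (1 + ((j : ℂ) + 1) * k) /
          Complex.Gamma (1 + ((n : ℂ) + j + 1) * k)))) := by
  have hk' : (0 : ℝ) < k := by exact_mod_cast hk
  have h1 (t : ℝ) : (t : ℂ) * selbergGammaProd (n + 1) k t 1 =
      (t * Complex.Gamma t) / Complex.Gamma (t + (1 + (n : ℂ) * k)) *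
      ∏ j ∈ Finset.range n, (Complex.Gamma (t + ((j : ℂ) + 1) * k) *
          Complex.Gamma (1 + ((j : ℂ) + 1) * k) /
          Complex.Gamma (t + (1 + ((n : ℂ) + j + 1) * k))) := by
    have e1 : (t : ℂ) + 1 + (n + 1 + 0 - 1) * k = t + (1 + n * k) := by ring
    have e2 (j : ℕ) : (t : ℂ) + 1 + (n + 1 + (j + 1) - 1) * k = t + (1 + (n + j + 1) * k) := by
      ring
    rw [selbergGammaProd, Finset.prod_range_succ']
    simp only [Nat.cast_add, Nat.cast_one, Nat.cast_zero, zero_mul, add_zero, Complex.Gamma_one,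
      mul_one, e2] at e1 ⊢
    rw [e1]
    ring
  simp only [h1]
  refine Tendsto.mul ?_ (tendsto_finsetProd _ fun j _ => ?_)
  · have hre : 0 < (1 + (n : ℂ) * k).re := by
      norm_num [Complex.add_re, Complex.mul_re]
      positivity
    exact tendsto_mul_Gamma_ofReal.div (tendsto_Gamma_add_ofReal hre)
      (Complex.Gamma_ne_zero_of_re_pos hre)
  · have hre1 : 0 < (((j : ℂ) + 1) * k).re := by
      norm_num [Complex.add_re, Complex.mul_re]
      positivity
    have hre2 : 0 < (1 + ((n : ℂ) + j + 1) * k).re := by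
      norm_num [Complex.add_re, Complex.mul_re]
      positivity
    exact ((tendsto_Gamma_add_ofReal hre1).mul_const _).div (tendsto_Gamma_add_ofReal hre2)
      (Complex.Gamma_ne_zero_of_re_pos hre2)

/-- Comparing the two evaluations of the limit, all but the end factors cancel by telescoping,
leaving the ratio (n+1)Γ((n+1)k)/Γ(k). -/
theorem selberg_constant_succ {n k : ℕ} (hk : 0 < k) {C C' : ℂ}
    (hC : ∀ a b : ℂ, 0 < a.re → 0 < b.re →
      selbergIntegral n k a b = C * selbergGammaProd n k a b)
    (hC' : ∀ a b : ℂ, 0 < a.re → 0 < b.re →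
      selbergIntegral (n + 1) k a b = C' * selbergGammaProd (n + 1) k a b) :
    C' = C * (Complex.Gamma (((n : ℂ) + 1) * k + 1) / Complex.Gamma ((k : ℂ) + 1)) := by
  have hk' : (0 : ℝ) < k := by exact_mod_cast hk
  have hlim := (tendsto_mul_selbergGammaProd_succ n hk).const_mul C'
  have heq := tendsto_nhds_unique (hlim.congr' (by
    filter_upwards [self_mem_nhdsWithin] with t ht
    rw [mul_left_comm, ← hC' t 1 (by simpa using ht) (by simp)]))
    (tendsto_mul_selbergIntegral_succ n hk)
  rw [hC (2 * k) 1 (by simpa using hk) (by simp), selbergGammaProd] at heq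
  have e (j : ℕ) : (2 * k + 1 + ((n : ℂ) + j - 1) * k) = 1 + ((n : ℂ) + j + 1) * k := by ring
  have e' (j : ℕ) : (2 * k + (j : ℂ) * k) = (((j + 1 : ℕ) : ℂ) + 1) * k := by push_cast; ring
  simp only [e, e', Finset.prod_div_distrib, Finset.prod_mul_distrib] at heq
  -- Splitting off the last or the first factor of the same product gives the two telescoping
  -- relations `t1` and `t2`.
  have t1 := (Finset.prod_range_succ (fun j : ℕ => Complex.Gamma (((j : ℂ) + 1) * k)) n).symm.trans
    (Finset.prod_range_succ' (fun j : ℕ => Complex.Gamma (((j : ℂ) + 1) * k)) n)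
  have t2 := (Finset.prod_range_succ (fun j : ℕ => Complex.Gamma (1 + (j : ℂ) * k)) n).symm.trans
    (Finset.prod_range_succ' (fun j : ℕ => Complex.Gamma (1 + (j : ℂ) * k)) n)
  have hnz {f : ℕ → ℂ} (hf : ∀ j, 0 < (f j).re) : ∏ j ∈ Finset.range n, Complex.Gamma (f j) ≠ 0 :=
    Finset.prod_ne_zero_iff.2 fun j _ => Complex.Gamma_ne_zero_of_re_pos (hf j)
  have n1 := hnz (f := fun j => ((j : ℂ) + 1) * k) fun j => by
    norm_num [Complex.add_re, Complex.mul_re]; positivity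
  have n2 := hnz (f := fun j => 1 + (j : ℂ) * k) fun j => by
    norm_num [Complex.add_re, Complex.mul_re]; positivity
  have n3 := hnz (f := fun j => 1 + ((n : ℂ) + j + 1) * k) fun j => by
    norm_num [Complex.add_re, Complex.mul_re]; positivity
  have n4 : Complex.Gamma (1 + (n : ℂ) * k) ≠ 0 := Complex.Gamma_ne_zero_of_re_pos (by
    norm_num [Complex.add_re, Complex.mul_re]; positivity)
  have hkc : (k : ℂ) ≠ 0 := by exact_mod_cast hk.ne'
  have n5 : Complex.Gamma (k : ℂ) ≠ 0 := Complex.Gamma_ne_zero_of_re_pos (by simpa using hk)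
  have hn1 : ((n : ℂ) + 1) ≠ 0 := by exact_mod_cast n.succ_ne_zero
  rw [Complex.Gamma_add_one _ hkc, Complex.Gamma_add_one _ (mul_ne_zero hn1 hkc)]
  simp only [Nat.cast_add, Nat.cast_one, Nat.cast_zero, zero_add, one_mul, zero_mul, add_zero,
    Complex.Gamma_one, mul_one] at t1 t2 heq
  generalize ∏ j ∈ Finset.range n, Complex.Gamma (((j : ℂ) + 1 + 1) * k) = A1 at *
  generalize ∏ j ∈ Finset.range n, Complex.Gamma (((j : ℂ) + 1) * k) = A at *
  generalize ∏ j ∈ Finset.range n, Complex.Gamma (1 + ((j : ℂ) + 1) * k) = B1 at *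
  generalize ∏ j ∈ Finset.range n, Complex.Gamma (1 + (j : ℂ) * k) = B at *
  generalize ∏ j ∈ Finset.range n, Complex.Gamma (1 + ((n : ℂ) + j + 1) * k) = E at *
  subst t2
  field_simp at heq ⊢
  have hB : C' * A * Complex.Gamma k = C * (n + 1) * (A * Complex.Gamma (((n : ℂ) + 1) * k)) := by
    rw [t1]
    linear_combination Complex.Gamma k * heq
  rw [mul_comm (k : ℂ) ((n : ℂ) + 1)]
  refine mul_left_cancel₀ n1 ?_
  linear_combination hB

/-! ### Closed form and the main theorem -/

theorem selbergIntegral_zero_dim (k : ℕ) {a b : ℂ} (ha : 0 < a.re) (hb : 0 < b.re) :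
    selbergIntegral 0 k a b = 1 := by
  rw [selbergIntegral_eq_sum 0 k ha hb]
  simp [tupleSign]

theorem selbergIntegral_eq_mul_prod (n k : ℕ) {a b : ℂ} (ha : 0 < a.re) (hb : 0 < b.re) :
    selbergIntegral n k a b =
      (∏ j ∈ Finset.range n,
        Complex.Gamma (((j : ℂ) + 1) * k + 1) / Complex.Gamma ((k : ℂ) + 1)) *
      selbergGammaProd n k a b := by
  -- For k = 0 all exponents vanish and the pole is no longer simple in general; but there is a
  -- single empty tuple, and the integral is B(a,b)^n.
  rcases Nat.eq_zero_or_pos k with rfl | hk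
  · rw [selbergIntegral_eq_sum n 0 ha hb]
    simp [tupleSign, tupleExponent, selbergGammaProd,
      Complex.betaIntegral_eq_Gamma_mul_div _ _ ha hb]
  induction n generalizing a b with
  | zero => simp [selbergIntegral_zero_dim k ha hb, selbergGammaProd]
  | succ n ih =>
    obtain ⟨C', hC'⟩ := exists_selbergIntegral_eq_mul (n + 1) k
    rw [hC' a b ha hb, selberg_constant_succ hk (fun a b ha hb => ih ha hb) hC',
      Finset.prod_range_succ]

theorem mainTheorem1 (k : ℕ) :
    (∀ (n : ℕ) (a b : ℂ), 0 < a.re → 0 < b.re →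
      IntegrableOn (selbergIntegrand n k a b) (Set.Icc (0 : Fin n → ℝ) 1) ∧
      selbergIntegral n k a b = (n.factorial : ℂ) * hyperdet (selbergTensor n k a b) ∧
      selbergIntegral n k a b =
        ∏ j ∈ Finset.range n,
          Complex.Gamma (a + (j : ℂ) * k) * Complex.Gamma (b + (j : ℂ) * k) *
              Complex.Gamma (((j : ℂ) + 1) * k + 1) /
            (Complex.Gamma (a + b + ((n : ℂ) + j - 1) * k) * Complex.Gamma ((k : ℂ) + 1))) ∧
    ∃ α : ℕ → ℂ,
      (∀ (n : ℕ) (a b : ℂ), 0 < a.re → 0 < b.re →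
        hyperdet (selbergTensor n k a b) =
          α n * ∏ j ∈ Finset.range n,
            Complex.Gamma (a + (j : ℂ) * k) * Complex.Gamma (b + (j : ℂ) * k) /
              Complex.Gamma (a + b + ((n : ℂ) + j - 1) * k)) ∧
      ∀ n : ℕ, 1 ≤ n →
        α n = ((n * k).factorial : ℂ) / ((n : ℂ) * (k.factorial : ℂ)) * α (n - 1) := by
  have hdet (n : ℕ) {a b : ℂ} (ha : 0 < a.re) (hb : 0 < b.re) :
      selbergIntegral n k a b = (n.factorial : ℂ) * hyperdet (selbergTensor n k a b) := by
    rw [selbergIntegral_eq_sum n k ha hb, factorial_mul_hyperdet_selbergTensor]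
  refine ⟨fun n a b ha hb => ⟨integrableOn_selbergIntegrand n k ha hb, hdet n ha hb, ?_⟩,
    -- The witness α_n is the constant of Selberg's formula divided by n!; the quotient of
    -- consecutive n! supplies the factor 1/n in the recursion.
    fun n => (n.factorial : ℂ)⁻¹ * ∏ j ∈ Finset.range n,
      Complex.Gamma (((j : ℂ) + 1) * k + 1) / Complex.Gamma ((k : ℂ) + 1),
    fun n a b ha hb => ?_, fun n hn => ?_⟩
  · rw [selbergIntegral_eq_mul_prod n k ha hb, selbergGammaProd, ← Finset.prod_mul_distrib]
    refine Finset.prod_congr rfl fun j _ => ?_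
    rw [div_mul_div_comm, mul_comm (Complex.Gamma ((k : ℂ) + 1))]
    congr 1
    ring
  · have hn : (n.factorial : ℂ) ≠ 0 := by exact_mod_cast n.factorial_ne_zero
    have h := (hdet n ha hb).symm.trans (selbergIntegral_eq_mul_prod n k ha hb)
    rw [mul_assoc, eq_inv_mul_iff_mul_eq₀ hn, h, selbergGammaProd]
  · obtain ⟨m, rfl⟩ : ∃ m, n = m + 1 := ⟨n - 1, by omega⟩
    have h : Complex.Gamma (((m : ℂ) + 1) * k + 1) = (((m + 1) * k).factorial : ℂ) := by
      rw [← Complex.Gamma_nat_eq_factorial]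
      push_cast
      rfl
    beta_reduce
    rw [Nat.add_sub_cancel, Finset.prod_range_succ, h, Complex.Gamma_nat_eq_factorial,
      Nat.factorial_succ, Nat.cast_mul, mul_inv]
    ring
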